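/- Let $N$ be a finite set of players with $\#N\ge 2$. For $K\in\{1,\dots,\#N\}$ let $\mathcal P(K)$ be the set of all partitions $P$ of $N$ into nonempty coalitions with at most $K$ members each. For every player $i$ and every partition $P$ of $N$ let $S_i(P)$ be a finite set of strategies, and put $S_i(K)=\bigcup_{P\in\mathcal P(K)}S_i(P)$ and $S(K)=\prod_{i\in N}S_i(K)$; in particular $S_i(1)\subseteq\dots\subseteq S_i(\#N)$. A coalition structure formation mechanism $\mathcal R(K)$ is a family of pairwise disjoint (possibly empty) sets $S(P)\subseteq S(K)$, $P\in\mathcal P(K)$, with $\bigcup_{P\in\mathcal P(K)}S(P)=S(K)$; a profile $s\in S(P)$ results in the final partition $P$. A coalition structure formation game $\Gamma(K)$ consists of such a mechanism together with payoff functions $U_i(P)\colon S(P)\to\mathbb R$ for all $i\in N$ and $P\in\mathcal P(K)$. Let $\Sigma_i(K)$ be the set of probability distributions on the finite set $S_i(K)$. For $\sigma\in\prod_{i\in N}\Sigma_i(K)$ the expected utility of player $i$ is $$EU_i^{\Gamma(K)}(\sigma)=\sum_{P\in\mathcal P(K)}\ \sum_{s\in S(P)}U_i(P)(s)\prod_{j\in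 N}\sigma_j(s_j),$$ and $\sigma^*$ is an equilibrium in mixed strategies of $\Gamma(K)$ if $EU_i^{\Gamma(K)}(\sigma_i^*,\sigma_{-i}^*)\ge EU_i^{\Gamma(K)}(\sigma_i,\sigma_{-i}^*)$ for all $i\in N$ and $\sigma_i\in\Sigma_i(K)$. A family $\Gamma(1),\dots,\Gamma(\#N)$ of such games (with the same sets $S_i(P)$) is nested, $\Gamma(1)\subset\dots\subset\Gamma(\#N)$, if for all $K\le L$ every profile in $S(K)$ results in the same final partition and has the same payoffs in $\Gamma(L)$ as in $\Gamma(K)$. **Theorem.** (1) For every $K\in\{1,\dots,\#N\}$ such that $S_i(K)\neq\emptyset$ for all $i\in N$, every game $\Gamma(K)$ has an equilibrium in mixed strategies. (2) If $S_i(1)\neq\emptyset$ for all $i\in N$, then every nested family of games $\mathcal G=\{\Gamma(K):K=1,\dots,\#N\}$ has an equilibrium in mixed strategies, that is, there is a tuple $\sigma^*(\mathcal G)=(\sigma^*(1),\dots,\sigma^*(\#N))$ in which $\sigma^*(K)$ is an equilibrium in mixed strategies of $\Gamma(K)$ for every $K$. -/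

import Mathlib

namespace CoalitionFormation

/-- A coalition structure: a partition of the set of players into nonempty, pairwise disjoint
coalitions. -/
abbrev CoalitionStructure (N : Type*) [Fintype N] [DecidableEq N] : Type _ :=
  Finpartition (Finset.univ : Finset N)

/-- The family `𝒫(K)` of coalition structures all of whose coalitions have at most `K` members. -/
def partitions (N : Type*) [Fintype N] [DecidableEq N] (K : ℕ) : Set (CoalitionStructure N) :=
  {P | ∀ g ∈ P.parts, g.card ≤ K}

theorem partitions_mono (N : Type*) [Fintype N] [DecidableEq N] {K L : ℕ} (h : K ≤ L) :
    partitions N K ⊆ partitions N L :=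
  fun _ hP g hg => (hP g hg).trans h

noncomputable instance (N : Type*) [Fintype N] [DecidableEq N] (K : ℕ) :
    Fintype (partitions N K) :=
  Fintype.ofFinite _

section

variable {N : Type*} [Fintype N] [DecidableEq N] {A : N → Type*}

/-- The strategy set `S_i(K)`, the union of the finite sets `S_i(P)` over `P ∈ 𝒫(K)`. Here `A i` is
the ambient type of strategies of player `i`. The sets `S_i(P)` may or may not be disjoint; a choice
of "a desirable partition and an action for it" is the case where the elements of `A i` are pairs
`(P, a)` and `S_i(P)` consists of pairs with first entry `P`. -/
def strategySet (S : (i : N) → CoalitionStructure N → Finset (A i)) (K : ℕ) (i : N) : Set (A i) :=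
  {a | ∃ P ∈ partitions N K, a ∈ S i P}

theorem strategySet_mono (S : (i : N) → CoalitionStructure N → Finset (A i)) {K L : ℕ}
    (h : K ≤ L) (i : N) : strategySet S K i ⊆ strategySet S L i :=
  fun _ ⟨P, hP, ha⟩ => ⟨P, partitions_mono N h hP, ha⟩

theorem strategySet_finite (S : (i : N) → CoalitionStructure N → Finset (A i)) (K : ℕ) (i : N) :
    (strategySet S K i).Finite := by
  refine (Set.finite_iUnion fun P : CoalitionStructure N => (S i P).finite_toSet).subset ?_
  rintro a ⟨P, -, ha⟩
  exact Set.mem_iUnion.2 ⟨P, ha⟩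

noncomputable instance (S : (i : N) → CoalitionStructure N → Finset (A i)) (K : ℕ) (i : N) :
    Fintype (strategySet S K i) :=
  (strategySet_finite S K i).fintype

/-- The set `S(K)` of pure strategy profiles, the product of the sets `S_i(K)`. -/
abbrev Profile (S : (i : N) → CoalitionStructure N → Finset (A i)) (K : ℕ) : Type _ :=
  (i : N) → strategySet S K i

/-- The inclusion `S(K) ⊆ S(L)` for `K ≤ L`. -/
def Profile.incl {S : (i : N) → CoalitionStructure N → Finset (A i)} {K L : ℕ} (h : K ≤ L)
    (s : Profile S K) : Profile S L :=
  fun i => ⟨s i, strategySet_mono S h i (s i).2⟩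

/-- A coalition structure formation mechanism `ℛ(K)`: it divides `S(K)` into pairwise disjoint
domains `S(P)`, `P ∈ 𝒫(K)`, some of which may be empty; a profile in `S(P)` results in the final
coalition structure `P`. -/
structure Mechanism (S : (i : N) → CoalitionStructure N → Finset (A i)) (K : ℕ) where
  /-- the coalition structure specific strategy set `S(P)` -/
  domain : partitions N K → Set (Profile S K)
  iUnion_domain : ⋃ P, domain P = Set.univ
  disjoint_domain : ∀ P Q, P ≠ Q → domain P ∩ domain Q = ∅

noncomputable instance {S : (i : N) → CoalitionStructure N → Finset (A i)} {K : ℕ}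
    (R : Mechanism S K) (P : partitions N K) : Fintype (R.domain P) :=
  Fintype.ofFinite _

/-- The coalition structure formation game `Γ(K)`: a mechanism, and for every player `i` and every
coalition structure `P` a payoff function `U_i(P)` on the domain `S(P)`. -/
structure Game (S : (i : N) → CoalitionStructure N → Finset (A i)) (K : ℕ) where
  mechanism : Mechanism S K
  payoff : (i : N) → (P : partitions N K) → mechanism.domain P → ℝ

/-- `Γ(K) ⊆ Γ(L)` for `K ≤ L`: on `S(K)`, the larger game forms the same coalition structures and
has the same payoffs as the smaller one. -/
def Game.IsSubgame {S : (i : N) → CoalitionStructure N → Finset (A i)} {K L : ℕ} (h : K ≤ L)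
    (Γ : Game S K) (Δ : Game S L) : Prop :=
  ∀ (P : partitions N K) (s : Γ.mechanism.domain P),
    ∃ hs : Profile.incl h s.1 ∈ Δ.mechanism.domain ⟨P.1, partitions_mono N h P.2⟩,
      ∀ i, Δ.payoff i ⟨P.1, partitions_mono N h P.2⟩ ⟨Profile.incl h s.1, hs⟩ = Γ.payoff i P s

/-- A family of games `Γ(K)`, `K = 1, …, #N`, is nested if `Γ(1) ⊆ Γ(2) ⊆ … ⊆ Γ(#N)`. -/
def IsNested {S : (i : N) → CoalitionStructure N → Finset (A i)}
    (Γ : (K : Set.Icc 1 (Fintype.card N)) → Game S K) : Prop :=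
  ∀ (K L : Set.Icc 1 (Fintype.card N)) (h : (K : ℕ) ≤ L), (Γ K).IsSubgame h (Γ L)

/-- The set `Σ_i(K)` of mixed strategies of player `i`: the probability weights on the finite set
`S_i(K)`. -/
abbrev MixedStrategy (S : (i : N) → CoalitionStructure N → Finset (A i)) (K : ℕ) (i : N) : Type _ :=
  stdSimplex ℝ (strategySet S K i)

/-- Profiles of mixed strategies. -/
abbrev MixedProfile (S : (i : N) → CoalitionStructure N → Finset (A i)) (K : ℕ) : Type _ :=
  (i : N) → MixedStrategy S K i

/-- The expected utility of player `i`, the sum over all coalition structures `P` of the integral of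
`U_i(P)` over `S(P)` against the product of the mixed strategies of the players. -/
noncomputable def Game.expectedUtility {S : (i : N) → CoalitionStructure N → Finset (A i)} {K : ℕ}
    (Γ : Game S K) (σ : MixedProfile S K) (i : N) : ℝ :=
  ∑ P : partitions N K, ∑ s : Γ.mechanism.domain P,
    Γ.payoff i P s * ∏ j, (σ j : strategySet S K j → ℝ) (s.1 j)

/-- A mixed strategy profile is an equilibrium of `Γ(K)` if no player gains in expected utility by
a unilateral change of mixed strategy. -/
def Game.IsEquilibrium {S : (i : N) → CoalitionStructure N → Finset (A i)} {K : ℕ}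
    (Γ : Game S K) (σ : MixedProfile S K) : Prop :=
  ∀ (i : N) (τ : MixedStrategy S K i),
    Γ.expectedUtility (Function.update σ i τ) i ≤ Γ.expectedUtility σ i

end

end CoalitionFormation

/-! Once the payoffs of all coalition structures are assembled into one function on `S(K)`, the game
`Γ(K)` is an ordinary finite game, and the first claim is Nash's theorem. For the second, `S_i(1) ⊆
S_i(K)` makes all strategy sets nonempty, and an equilibrium is chosen for each `K`.

Nash's theorem is proved from scratch. A parity argument on dominant sets gives Scarf's lemma
(`Scarf.exists_colourful`), a combinatorial substitute for Sperner's lemma that needs no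
triangulation. Applied to the grid points of a simplex it yields almost fixed points, and
compactness turns these into Brouwer's theorem (`Brouwer.exists_fixed_point`). Nash's map acts on a
product of simplices; a retraction from one large simplex makes Brouwer's theorem applicable
(`Nash.exists_stationary`). -/

/-! ### Scarf's lemma on dominant sets. -/

namespace Scarf

open Finset

/-- Exactly one pair of elements collides under `f`, and only its two members can be deleted without
losing a value. -/
theorem card_filter_image_erase_eq_two {α β : Type*} [DecidableEq α] [DecidableEq β]
    (s : Finset α) (f : α → β) (h : (s.image f).card + 1 = s.card) :
    (s.filter fun k => (s.erase k).image f = s.image f).card = 2 := by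
  have hninj : ¬ Set.InjOn f s := fun hi => by
    rw [card_image_of_injOn hi] at h; omega
  simp only [Set.InjOn, not_forall] at hninj
  obtain ⟨a, ha, b, hb, hab, hne⟩ := hninj
  have ha' : a ∈ s := ha
  have hb' : b ∈ s := hb
  have key : ∀ k ∈ s, (∃ l ∈ s, l ≠ k ∧ f l = f k) → (s.erase k).image f = s.image f := by
    rintro k hk ⟨l, hl, hlk, hf⟩
    refine Subset.antisymm (image_subset_image (erase_subset _ _)) fun y hy => ?_
    obtain ⟨x, hx, rfl⟩ := mem_image.1 hy
    by_cases hxk : x = k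
    · subst hxk
      exact mem_image.2 ⟨l, mem_erase.2 ⟨hlk, hl⟩, hf⟩
    · exact mem_image.2 ⟨x, mem_erase.2 ⟨hxk, hx⟩, rfl⟩
  have hA := key a ha' ⟨b, hb', Ne.symm hne, hab.symm⟩
  have hB := key b hb' ⟨a, ha', hne, hab⟩
  have hinj : Set.InjOn f (s.erase a : Finset α) := by
    apply card_image_iff.1
    rw [hA, card_erase_of_mem ha']
    omega
  have : (s.filter fun k => (s.erase k).image f = s.image f) = {a, b} := by
    ext k
    simp only [mem_filter, mem_insert, mem_singleton]
    constructor
    · rintro ⟨hk, hk'⟩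
      by_contra! hkab
      have : f k ∈ (s.erase k).image f := by rw [hk']; exact mem_image_of_mem f hk
      obtain ⟨l, hl, hlk⟩ := mem_image.1 this
      obtain ⟨hne', hl⟩ := mem_erase.1 hl
      have hkm : k ∈ (s.erase a : Finset α) := mem_erase.2 ⟨hkab.1, hk⟩
      by_cases hla : l = a
      · subst hla
        exact hkab.2 (hinj hkm (mem_erase.2 ⟨Ne.symm hne, hb'⟩) (hlk.symm.trans hab))
      · exact hne' (hinj (mem_erase.2 ⟨hla, hl⟩) hkm hlk)
    · rintro (rfl | rfl)
      · exact ⟨ha', hA⟩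
      · exact ⟨hb', hB⟩
  rw [this, card_pair hne]

variable {I V R : Type*} [Fintype I] [DecidableEq I] [Fintype V] [DecidableEq V] [LinearOrder R]

/-- A set of vertices is dominant for a family of rankings if no vertex strictly exceeds, in every
ranking, the minimum of the set. -/
def Dominant (r : I → V → R) (s : Finset V) : Prop :=
  ∀ y, ∃ i, ∀ x ∈ s, r i y ≤ r i x

omit [Fintype I] [DecidableEq I] [Fintype V] [DecidableEq V] in
theorem Dominant.mono {r : I → V → R} {s t : Finset V} (h : Dominant r t) (hst : s ⊆ t) :
    Dominant r s :=
  fun y => (h y).imp fun _ hi x hx => hi x (hst hx)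

/-- The rankings have corners: `e i` is lowest in the `i`-th ranking, and all other corners exceed
the vertices that are not corners. -/
structure IsCorner (r : I → V → R) (e : I → V) : Prop where
  inj : Function.Injective e
  bot : ∀ i x, r i (e i) ≤ r i x
  top : ∀ i j, i ≠ j → ∀ x, x ∉ Set.range e → r i x < r i (e j)

/-- The vertices exceeding the minimum of `s` in every ranking except possibly the `k`-th. -/
def above (r : I → V → R) (s : Finset V) (k : I) : Set V :=
  {y | ∀ i, i ≠ k → ∃ x ∈ s, r i x < r i y}

omit [DecidableEq I] [Fintype V] in
-- Dominance tested on a member `y` of `s` says that `y` is itself the minimum of `s` in some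
-- ranking.
theorem image_argmin {r : I → V → R} (hr : ∀ i, Function.Injective (r i)) {s : Finset V}
    (hs : Dominant r s) {m : I → V} (hm : ∀ i, m i ∈ s ∧ ∀ x ∈ s, r i (m i) ≤ r i x) :
    univ.image m = s := by
  ext y
  simp only [mem_image, mem_univ, true_and]
  constructor
  · rintro ⟨i, rfl⟩
    exact (hm i).1
  · intro hy
    obtain ⟨i, hi⟩ := hs y
    exact ⟨i, hr i (le_antisymm ((hm i).2 y hy) (hi _ (hm i).1))⟩

open Classical in
-- A vertex `y` extending `s` becomes the minimum in exactly one ranking `k`. The old minima in the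
-- other rankings must then still exhaust `s`, and `y` must be the `k`-highest vertex of `above r s
-- k`. Thus `k` determines `y`.
theorem card_extensions {r : I → V → R} (hr : ∀ i, Function.Injective (r i)) {s : Finset V}
    (hcard : s.card + 1 = Fintype.card I) (hs : Dominant r s) {m : I → V}
    (hm : ∀ i, m i ∈ s ∧ ∀ x ∈ s, r i (m i) ≤ r i x) :
    (univ.filter fun y => y ∉ s ∧ Dominant r (insert y s)).card =
      (univ.filter fun k => (univ.erase k).image m = univ.image m ∧
        (above r s k).Nonempty).card := by
  have him := image_argmin hr hs hm
  have hmax : ∀ k, ∃ y, (above r s k).Nonempty →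
      y ∈ above r s k ∧ ∀ z ∈ above r s k, r k z ≤ r k y := by
    intro k
    by_cases h : (above r s k).Nonempty
    · obtain ⟨y, hy, hy'⟩ := Set.exists_max_image (above r s k) (r k) (Set.toFinite _) h
      exact ⟨y, fun _ => ⟨hy, hy'⟩⟩
    -- A dummy value; such `k` are not counted.
    · exact ⟨m k, fun h' => absurd h' h⟩
  choose y hy using hmax
  symm
  refine card_bij (fun k _ => y k) ?_ ?_ ?_
  · intro k hk
    simp only [mem_filter, mem_univ, true_and] at hk ⊢
    obtain ⟨hk, hne⟩ := hk
    obtain ⟨hyk, hymax⟩ := hy k hne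
    constructor
    · intro hys
      rw [him] at hk
      rw [← hk] at hys
      obtain ⟨i, hi, hiy⟩ := mem_image.1 hys
      obtain ⟨x, hx, hlt⟩ := hyk i (mem_erase.1 hi).1
      rw [← hiy] at hlt
      exact absurd ((hm i).2 x hx) (not_le.2 hlt)
    · intro z
      by_cases hz : z ∈ above r s k
      · obtain ⟨i, hi⟩ := hs z
        have hik : i = k := by
          by_contra hik
          obtain ⟨x, hx, hlt⟩ := hz i hik
          exact absurd (hi x hx) (not_le.2 hlt)
        subst hik
        refine ⟨i, fun x hx => ?_⟩
        rcases mem_insert.1 hx with rfl | hx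
        · exact hymax z hz
        · exact hi x hx
      · simp only [above, Set.mem_ofPred_eq, not_forall, not_exists, not_and, not_lt] at hz
        obtain ⟨i, hik, hi⟩ := hz
        refine ⟨i, fun x hx => ?_⟩
        rcases mem_insert.1 hx with rfl | hx
        · obtain ⟨x, hx, hlt⟩ := hyk i hik
          exact (hi x hx).trans hlt.le
        · exact hi x hx
  · intro a ha b hb hab
    simp only [mem_filter, mem_univ, true_and] at ha hb
    by_contra hne
    obtain ⟨i, hi⟩ := hs (y a)
    by_cases hia : i = a
    · subst hia
      rw [hab] at hi
      obtain ⟨x, hx, hlt⟩ := (hy b hb.2).1 i hne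
      exact absurd (hi x hx) (not_le.2 hlt)
    · obtain ⟨x, hx, hlt⟩ := (hy a ha.2).1 i hia
      exact absurd (hi x hx) (not_le.2 hlt)
  · intro z hz
    simp only [mem_filter, mem_univ, true_and] at hz
    obtain ⟨hzs, hz⟩ := hz
    have hsub : ∀ k, (∀ x ∈ s, r k z ≤ r k x) → s ⊆ (univ.erase k).image m ∧
        z ∈ above r s k ∧ ∀ z' ∈ above r s k, r k z' ≤ r k z := by
      intro k hk
      have hks : s ⊆ (univ.erase k).image m := by
        intro x hx
        obtain ⟨i, hi⟩ := hz x
        have hik : i ≠ k := by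
          rintro rfl
          have := hr i (le_antisymm (hi z (mem_insert_self _ _)) (hk x hx))
          exact hzs (this ▸ hx)
        exact mem_image.2 ⟨i, mem_erase.2 ⟨hik, mem_univ _⟩,
          hr i (le_antisymm ((hm i).2 x hx) (hi _ (mem_insert_of_mem (hm i).1)))⟩
      have hinj : Set.InjOn m (univ.erase k : Finset I) := by
        apply card_image_iff.1
        apply le_antisymm card_image_le
        rw [card_erase_of_mem (mem_univ _), card_univ, ← hcard]
        exact card_le_card hks
      have hza : z ∈ above r s k := by
        intro i hik
        by_contra! hcon
        -- If `z` were lowest in two rankings, the other `#I - 2` minima would have to cover the `#I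
        -- - 1` elements of `s`.
        have hsub' : s ⊆ ((univ.erase k).erase i).image m := by
          intro x hx
          obtain ⟨j, hj⟩ := hz x
          have hjk : ∀ l, (∀ x ∈ s, r l z ≤ r l x) → j ≠ l := by
            rintro l hl rfl
            have := hr j (le_antisymm (hj z (mem_insert_self _ _)) (hl x hx))
            exact hzs (this ▸ hx)
          exact mem_image.2 ⟨j, mem_erase.2 ⟨hjk i hcon, mem_erase.2 ⟨hjk k hk, mem_univ _⟩⟩,
            hr j (le_antisymm ((hm j).2 x hx) (hj _ (mem_insert_of_mem (hm j).1)))⟩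
        have := (card_le_card hsub').trans card_image_le
        rw [card_erase_of_mem (mem_erase.2 ⟨hik, mem_univ _⟩), card_erase_of_mem (mem_univ _),
          card_univ] at this
        have : 0 < s.card := card_pos.2 ⟨_, (hm k).1⟩
        omega
      refine ⟨hks, hza, fun z' hz' => ?_⟩
      obtain ⟨i, hi⟩ := hz z'
      have hik : i = k := by
        by_contra hik
        obtain ⟨x, hx, hlt⟩ := hz' i hik
        exact absurd (hi x (mem_insert_of_mem hx)) (not_le.2 hlt)
      subst hik
      exact hi z (mem_insert_self _ _)
    obtain ⟨k, hk⟩ := hz z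
    obtain ⟨h1, h2, h3⟩ := hsub k fun x hx => hk x (mem_insert_of_mem hx)
    refine ⟨k, ?_, ?_⟩
    · simp only [mem_filter, mem_univ, true_and]
      refine ⟨Subset.antisymm (image_subset_image (erase_subset _ _)) (him ▸ h1), z, h2⟩
    · obtain ⟨h4, h5⟩ := hy k ⟨z, h2⟩
      exact hr k (le_antisymm (h3 _ h4) (h5 _ h2))

omit [Fintype V] in
theorem corner_mem_above {r : I → V → R} (hr : ∀ i, Function.Injective (r i)) {e : I → V}
    (he : IsCorner r e) {s : Finset V} (hcard : s.card + 1 = Fintype.card I) {k : I}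
    (hk : e k ∉ s) : e k ∈ above r s k := by
  intro i hik
  by_cases hsub : s ⊆ (univ.erase k).image e
  · have : s = (univ.erase k).image e := eq_of_subset_of_card_le hsub <| by
      rw [card_image_of_injective _ he.inj, card_erase_of_mem (mem_univ _), card_univ]
      omega
    refine ⟨e i, this ▸ mem_image_of_mem e (mem_erase.2 ⟨hik, mem_univ _⟩), ?_⟩
    exact lt_of_le_of_ne (he.bot i _) fun h => hik (he.inj (hr i h))
  · obtain ⟨x, hx, hx'⟩ := not_subset.1 hsub
    refine ⟨x, hx, he.top i k hik x ?_⟩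
    rintro ⟨j, rfl⟩
    refine hx' (mem_image_of_mem e (mem_erase.2 ⟨?_, mem_univ _⟩))
    rintro rfl
    exact hk hx

omit [Fintype V] in
theorem eq_boundary {r : I → V → R} {e : I → V}
    (he : IsCorner r e) {s : Finset V} (hcard : s.card + 1 = Fintype.card I) {i k : I}
    (hik : i ≠ k) (hk : ∀ x ∈ s, r i (e k) ≤ r i x) : ∃ j, s = (univ.erase j).image e := by
  have hsub : s ⊆ univ.image e := by
    intro x hx
    by_contra hx'
    refine absurd (hk x hx) (not_le.2 (he.top i k hik x ?_))
    rintro ⟨j, rfl⟩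
    exact hx' (mem_image_of_mem e (mem_univ j))
  have hlt : s.card < (univ.image e).card := by
    rw [card_image_of_injective _ he.inj, card_univ]
    omega
  obtain ⟨x, hx, hxs⟩ := exists_mem_notMem_of_card_lt_card hlt
  obtain ⟨j, -, rfl⟩ := mem_image.1 hx
  refine ⟨j, eq_of_subset_of_card_le ?_ ?_⟩
  · intro y hy
    obtain ⟨l, -, rfl⟩ := mem_image.1 (hsub hy)
    refine mem_image_of_mem e (mem_erase.2 ⟨?_, mem_univ _⟩)
    rintro rfl
    exact hxs hy
  · rw [card_image_of_injective _ he.inj, card_erase_of_mem (mem_univ _), card_univ]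
    omega

omit [Fintype I] [DecidableEq I] [Fintype V] [DecidableEq V] in
theorem exists_argmin (r : I → V → R) {s : Finset V} (hs : s.Nonempty) :
    ∃ m : I → V, ∀ i, m i ∈ s ∧ ∀ x ∈ s, r i (m i) ≤ r i x := by
  choose m hm using fun i => exists_min_image s (r i) hs
  exact ⟨m, hm⟩

open Classical in
-- The minima `m` have one colliding pair of indices, and away from the boundary both indices `k`
-- give an extension, because `e k` lies in `above r s k`.
theorem card_extensions_eq_two {r : I → V → R} (hr : ∀ i, Function.Injective (r i)) {e : I → V}
    (he : IsCorner r e) {s : Finset V} (hne : s.Nonempty)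
    (hcard : s.card + 1 = Fintype.card I) (hs : Dominant r s)
    (hb : ∀ j, s ≠ (univ.erase j).image e) :
    (univ.filter fun y => y ∉ s ∧ Dominant r (insert y s)).card = 2 := by
  obtain ⟨m, hm⟩ := exists_argmin r hne
  have him := image_argmin hr hs hm
  rw [card_extensions hr hcard hs hm,
    ← card_filter_image_erase_eq_two (univ : Finset I) m (by rw [him, hcard, card_univ])]
  congr 1
  ext k
  simp only [mem_filter, mem_univ, true_and, and_iff_left_iff_imp]
  intro hk
  refine ⟨e k, corner_mem_above hr he hcard fun hks => ?_⟩
  rw [← him, ← hk] at hks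
  obtain ⟨i, hi, hie⟩ := mem_image.1 hks
  obtain ⟨j, hj⟩ := eq_boundary he hcard (mem_erase.1 hi).1 (hie ▸ (hm i).2)
  exact hb j hj

open Classical in
-- The colliding indices are `j` and the `k` with `m j = e k`. Only `j` gives an extension: no
-- vertex lies above the facet in all rankings except `k`.
theorem card_extensions_boundary [Nontrivial I] {r : I → V → R}
    (hr : ∀ i, Function.Injective (r i)) {e : I → V} (he : IsCorner r e) (j : I)
    (hs : Dominant r ((univ.erase j).image e)) :
    (univ.filter fun y => y ∉ (univ.erase j).image e ∧
      Dominant r (insert y ((univ.erase j).image e))).card = 1 := by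
  have hcard : ((univ.erase j).image e).card + 1 = Fintype.card I := by
    rw [card_image_of_injective _ he.inj, card_erase_of_mem (mem_univ _), card_univ]
    have := Fintype.card_pos (α := I)
    omega
  have hmem : ∀ i, i ≠ j → e i ∈ (univ.erase j).image e := fun i hi =>
    mem_image_of_mem e (mem_erase.2 ⟨hi, mem_univ _⟩)
  have hnot : e j ∉ (univ.erase j).image e := by
    intro h
    obtain ⟨i, hi, hij⟩ := mem_image.1 h
    exact (mem_erase.1 hi).1 (he.inj hij)
  obtain ⟨l, hl⟩ := exists_ne j
  obtain ⟨m, hm⟩ := exists_argmin r ⟨e l, hmem l hl⟩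
  have him := image_argmin hr hs hm
  have hme : ∀ i, i ≠ j → m i = e i := fun i hi =>
    hr i (le_antisymm ((hm i).2 _ (hmem i hi)) (he.bot i _))
  rw [card_extensions hr hcard hs hm, card_eq_one]
  refine ⟨j, ?_⟩
  ext k
  simp only [mem_filter, mem_univ, true_and, mem_singleton]
  constructor
  · rintro ⟨hk, y, hy⟩
    by_contra hkj
    have hks := hmem k hkj
    rw [← him, ← hk] at hks
    obtain ⟨i, hi, hie⟩ := mem_image.1 hks
    have hij : i = j := by
      by_contra hij
      rw [hme i hij] at hie
      exact (mem_erase.1 hi).1 (he.inj hie)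
    subst hij
    obtain ⟨x, hx, hlt⟩ := hy i (Ne.symm hkj)
    by_cases hyr : y ∈ Set.range e
    · obtain ⟨p, rfl⟩ := hyr
      by_cases hpi : p = k
      · subst hpi
        rw [← hie] at hlt
        exact absurd ((hm i).2 x hx) (not_le.2 hlt)
      · obtain ⟨x', -, hlt'⟩ := hy p hpi
        exact absurd (he.bot p x') (not_le.2 hlt')
    · obtain ⟨q, hq, rfl⟩ := mem_image.1 hx
      exact absurd (he.top i q (Ne.symm (mem_erase.1 hq).1) y hyr) (not_lt.2 hlt.le)
  · rintro rfl
    refine ⟨?_, e k, corner_mem_above hr he hcard hnot⟩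
    rw [him]
    exact image_congr fun i hi => hme i (by simpa using hi)

omit [Fintype V] in
theorem dominant_boundary {r : I → V → R} {e : I → V} (he : IsCorner r e) (j : I) :
    Dominant r ((univ.erase j).image e) := by
  intro y
  by_cases hy : y ∈ Set.range e
  · obtain ⟨i, rfl⟩ := hy
    exact ⟨i, fun x _ => he.bot i x⟩
  · refine ⟨j, fun x hx => ?_⟩
    obtain ⟨i, hi, rfl⟩ := mem_image.1 hx
    exact (he.top j i (Ne.symm (mem_erase.1 hi).1) y hy).le

omit [DecidableEq I] in
open Classical in
theorem card_supersets (r : I → V → R) {s : Finset V} (hcard : s.card + 1 = Fintype.card I) :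
    ((univ.filter fun t : Finset V => t.card = Fintype.card I ∧ Dominant r t).filter
      fun t => s ⊆ t).card = (univ.filter fun y => y ∉ s ∧ Dominant r (insert y s)).card := by
  symm
  refine card_bij (fun y _ => insert y s) ?_ ?_ ?_
  · intro y hy
    simp only [mem_filter, mem_univ, true_and] at hy ⊢
    exact ⟨⟨by rw [card_insert_of_notMem hy.1, hcard], hy.2⟩, subset_insert _ _⟩
  · intro a ha b hb hab
    simp only [mem_filter, mem_univ, true_and] at ha hb
    have : a ∈ insert b s := hab ▸ mem_insert_self a s
    exact (mem_insert.1 this).resolve_right ha.1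
  · intro t ht
    simp only [mem_filter, mem_univ, true_and] at ht
    obtain ⟨⟨htc, htd⟩, hst⟩ := ht
    obtain ⟨y, hy, hys⟩ := exists_mem_notMem_of_card_lt_card (s := s) (t := t) (by omega)
    have : insert y s = t := eq_of_subset_of_card_le (insert_subset hy hst) (by
      rw [card_insert_of_notMem hys]; omega)
    exact ⟨y, by simp [hys, this, htd], this⟩

open Classical in
-- If `t` shows all colours but `i₀`, one colour is repeated and either of its two bearers can be
-- dropped; otherwise `t` has no such facet.
theorem even_card_facets {r : I → V → R} {c : V → I} {i₀ : I} {t : Finset V}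
    (htc : t.card = Fintype.card I) (htd : Dominant r t) (ht : t.image c ≠ univ) :
    Even ((univ.filter fun s : Finset V => s.card + 1 = Fintype.card I ∧ Dominant r s ∧
      s.image c = univ.erase i₀).filter fun s => s ⊆ t).card := by
  by_cases him : t.image c = univ.erase i₀
  · have hcard : (t.image c).card + 1 = t.card := by
      rw [him, card_erase_of_mem (mem_univ _), card_univ, htc]
      have := Fintype.card_pos_iff.2 ⟨i₀⟩
      omega
    have h2 := card_filter_image_erase_eq_two t c hcard
    refine (fun n h => h ▸ even_two : ∀ n : ℕ, n = 2 → Even n) _ ?_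
    rw [← h2]
    symm
    refine card_bij (fun x _ => t.erase x) ?_ ?_ ?_
    · intro x hx
      simp only [mem_filter, mem_univ, true_and] at hx ⊢
      exact ⟨⟨by rw [card_erase_add_one hx.1, htc], htd.mono (erase_subset _ _),
        hx.2.trans him⟩, erase_subset _ _⟩
    · intro a ha b hb hab
      simp only [mem_filter] at ha hb
      by_contra hne
      have : a ∈ t.erase b := mem_erase.2 ⟨hne, ha.1⟩
      rw [← hab] at this
      exact notMem_erase a t this
    · intro s hs
      simp only [mem_filter, mem_univ, true_and] at hs
      obtain ⟨⟨hsc, hsd, hsi⟩, hst⟩ := hs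
      obtain ⟨x, hx, hxs⟩ := exists_mem_notMem_of_card_lt_card (s := s) (t := t) (by omega)
      have : s = t.erase x := eq_of_subset_of_card_le
        (fun y hy => mem_erase.2 ⟨fun h => hxs (h ▸ hy), hst hy⟩) (by
          rw [card_erase_of_mem hx]; omega)
      refine ⟨x, ?_, this.symm⟩
      simp only [mem_filter]
      exact ⟨hx, by rw [← this, hsi, him]⟩
  · rw [filter_eq_empty_iff.2]
    · simp
    · intro s hs hst
      simp only [mem_filter, mem_univ, true_and] at hs
      have hsub : univ.erase i₀ ⊆ t.image c := hs.2.2 ▸ image_subset_image hst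
      by_cases hi : i₀ ∈ t.image c
      · refine ht (eq_univ_iff_forall.2 fun i => ?_)
        by_cases h : i = i₀
        · exact h ▸ hi
        · exact hsub (mem_erase.2 ⟨h, mem_univ _⟩)
      · exact him (Subset.antisymm
          (fun i h => mem_erase.2 ⟨fun h' => hi (h' ▸ h), mem_univ _⟩) hsub)

/-- Scarf's lemma: any colouring of the vertices that colours the `i`-th corner by `i` has a
dominant set on which the colouring is a bijection. -/
theorem exists_colourful [Nontrivial I] {r : I → V → R} (hr : ∀ i, Function.Injective (r i))
    {e : I → V} (he : IsCorner r e) (c : V → I) (hc : ∀ i, c (e i) = i) :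
    ∃ t : Finset V, t.card = Fintype.card I ∧ Dominant r t ∧ t.image c = univ := by
  classical
  by_contra! hcon
  obtain ⟨i₀⟩ := (inferInstance : Nonempty I)
  have hcard_univ : 2 ≤ Fintype.card I := Fintype.one_lt_card
  -- Count incidences between facets missing only the colour `i₀` and full dominant sets. Without a
  -- colourful set every full set contributes an even number, whereas the facets contribute an odd
  -- one: the boundary facet opposite `e i₀` lies in one full set, all others in two.
  have hdc := sum_card_bipartiteAbove_eq_sum_card_bipartiteBelow
    (s := univ.filter fun s : Finset V => s.card + 1 = Fintype.card I ∧ Dominant r s ∧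
      s.image c = univ.erase i₀)
    (t := univ.filter fun t : Finset V => t.card = Fintype.card I ∧ Dominant r t)
    (fun s t => s ⊆ t)
  have hbd : (univ.erase i₀).image e ∈ univ.filter fun s : Finset V =>
      s.card + 1 = Fintype.card I ∧ Dominant r s ∧ s.image c = univ.erase i₀ := by
    simp only [mem_filter, mem_univ, true_and]
    refine ⟨?_, dominant_boundary he i₀, ?_⟩
    · rw [card_image_of_injective _ he.inj, card_erase_of_mem (mem_univ _), card_univ]
      omega
    · rw [image_image, (funext hc : c ∘ e = id), image_id]
  have heven : Even (∑ t ∈ univ.filter fun t : Finset V => t.card = Fintype.card I ∧ Dominant r t,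
      (bipartiteBelow (fun s t : Finset V => s ⊆ t)
        (univ.filter fun s : Finset V => s.card + 1 = Fintype.card I ∧ Dominant r s ∧
          s.image c = univ.erase i₀) t).card) := by
    refine even_sum _ fun t ht => ?_
    simp only [mem_filter, mem_univ, true_and] at ht
    exact even_card_facets ht.1 ht.2 (hcon t ht.1 ht.2)
  rw [← hdc, ← add_sum_erase _ _ hbd] at heven
  have hone : (bipartiteAbove (fun s t : Finset V => s ⊆ t)
      (univ.filter fun t : Finset V => t.card = Fintype.card I ∧ Dominant r t)
      ((univ.erase i₀).image e)).card = 1 := by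
    rw [bipartiteAbove, card_supersets r (by simpa using (mem_filter.1 hbd).2.1)]
    exact card_extensions_boundary hr he i₀ (dominant_boundary he i₀)
  rw [hone, add_comm, Nat.even_add_one] at heven
  refine heven (even_sum _ fun s hs => ?_)
  simp only [mem_erase, mem_filter, mem_univ, true_and] at hs
  obtain ⟨hsb, hsc, hsd, hsi⟩ := hs
  rw [bipartiteAbove, card_supersets r hsc, card_extensions_eq_two hr he
    (card_pos.1 (by omega)) hsc hsd]
  · exact even_two
  · rintro j rfl
    rw [image_image, (funext hc : c ∘ e = id), image_id] at hsi
    have : j = i₀ := by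
      by_contra hj
      have : j ∈ univ.erase i₀ := mem_erase.2 ⟨hj, mem_univ _⟩
      rw [← hsi] at this
      exact notMem_erase j _ this
    exact hsb (this ▸ rfl)

end Scarf

/-! ### Brouwer's fixed point theorem for the simplex. -/

namespace Brouwer

open Finset

variable {ι : Type*} [Fintype ι] [DecidableEq ι]

/-- The value by which the grid points of the `n`-fold simplex and the corners are ranked in the
direction `i`. -/
def height (n : ℕ) (i : ι) : (piAntidiag (univ : Finset ι) n) ⊕ ι → ℕ
  | .inl x => x.1 i + 1
  | .inr j => if i = j then 0 else n + 2

/-- The ranking by height, with ties broken by an enumeration. -/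
noncomputable def rank (n : ℕ) (i : ι) (y : (piAntidiag (univ : Finset ι) n) ⊕ ι) :
    ℕ ×ₗ Fin (Fintype.card ((piAntidiag (univ : Finset ι) n) ⊕ ι)) :=
  toLex (height n i y, Fintype.equivFin _ y)

theorem rank_injective (n : ℕ) (i : ι) : Function.Injective (rank n i) := fun a b h => by
  have := congrArg (fun z => (ofLex z).2) h
  exact (Fintype.equivFin _).injective this

theorem rank_lt {n : ℕ} {i : ι} {a b : (piAntidiag (univ : Finset ι) n) ⊕ ι}
    (h : height n i a < height n i b) : rank n i a < rank n i b :=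
  Prod.Lex.toLex_lt_toLex.2 (Or.inl h)

theorem height_le {n : ℕ} {i : ι} {a b : (piAntidiag (univ : Finset ι) n) ⊕ ι}
    (h : rank n i a ≤ rank n i b) : height n i a ≤ height n i b :=
  not_lt.1 fun h' => not_lt.2 h (rank_lt h')

theorem isCorner_inr (n : ℕ) : Scarf.IsCorner (rank (ι := ι) n) Sum.inr where
  inj := Sum.inr_injective
  bot i x := by
    by_cases hx : x = .inr i
    · rw [hx]
    · refine (rank_lt ?_).le
      rcases x with x | j
      · simp [height]
      · have : i ≠ j := fun h => hx (h ▸ rfl)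
        simp [height, this]
  top i j hij x hx := by
    refine rank_lt ?_
    rcases x with x | k
    · have hx := (mem_piAntidiag.1 x.2).1
      have : x.1 i ≤ n :=
        (single_le_sum (f := x.1) (fun _ _ => Nat.zero_le _) (mem_univ i)).trans_eq hx
      simp only [height, hij, if_false]
      omega
    · exact absurd ⟨k, rfl⟩ hx

/-- The grid points of a colourful dominant set lie close together. A colour is carried either by
one of them or by its formal corner, and in the latter case that coordinate is small. -/
theorem exists_colourful_cell [Nontrivial ι] (n : ℕ) (c : (ι → ℕ) → ι) :
    ∃ p : ι → ℕ, ∑ j, p j = n ∧ ∀ i, p i ≤ Fintype.card ι ∨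
      ∃ q : ι → ℕ, ∑ j, q j = n ∧ c q = i ∧
        ∀ j, q j ≤ p j + Fintype.card ι ∧ p j ≤ q j + Fintype.card ι := by
  classical
  obtain ⟨t, -, htd, htc⟩ := Scarf.exists_colourful (rank_injective n) (isCorner_inr n)
    (Sum.elim (fun x => c x.1) id) (fun _ => rfl)
  have hgrid : ∀ q : ι → ℕ, ∑ j, q j = n → q ∈ piAntidiag (univ : Finset ι) n := fun q hq =>
    mem_piAntidiag.2 ⟨hq, fun _ _ => mem_univ _⟩
  have hsum : ∀ q : piAntidiag (univ : Finset ι) n, ∑ j, q.1 j = n := fun q =>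
    (mem_piAntidiag.1 q.2).1
  have hdom : ∀ y : ι → ℕ, ∑ j, y j = n → ∃ i, .inr i ∉ t ∧ ∀ q, .inl q ∈ t → y i ≤ q.1 i := by
    intro y hy
    obtain ⟨i, hi⟩ := htd (.inl ⟨y, hgrid y hy⟩)
    refine ⟨i, fun h => ?_, fun q hq => ?_⟩
    · have := height_le (hi _ h)
      simp [height] at this
    · have := height_le (hi _ hq)
      simpa [height] using this
  have hcol : ∀ i, .inr i ∉ t → ∃ q, .inl q ∈ t ∧ c q.1 = i := by
    intro i hi
    have : i ∈ t.image (Sum.elim (fun x => c x.1) id) := by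
      rw [htc]; exact mem_univ i
    obtain ⟨y, hy, hyi⟩ := mem_image.1 this
    rcases y with q | j
    · exact ⟨q, hy, hyi⟩
    · simp only [Sum.elim_inr, id] at hyi
      exact absurd (hyi ▸ hy) hi
  obtain ⟨i₁⟩ := (inferInstance : Nonempty ι)
  -- Dominance tested on any grid point shows that some corner is missing from `t`, so `t` contains
  -- a grid point `p`.
  obtain ⟨i₂, hi₂, -⟩ := hdom (Pi.single i₁ n) (by simp)
  obtain ⟨p, hp, -⟩ := hcol i₂ hi₂
  have hmin : ∀ i, ∃ m : ℕ, (.inr i ∈ t → m = 0) ∧ (.inr i ∉ t → ∃ q, .inl q ∈ t ∧ q.1 i = m) ∧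
      ∀ q, .inl q ∈ t → m ≤ q.1 i := by
    intro i
    by_cases hi : .inr i ∈ t
    · exact ⟨0, fun _ => rfl, fun h => absurd hi h, fun _ _ => Nat.zero_le _⟩
    · obtain ⟨q, hq, hq'⟩ := exists_min_image
        (univ.filter fun q : piAntidiag (univ : Finset ι) n => .inl q ∈ t) (fun q => q.1 i)
        ⟨p, by simpa using hp⟩
      simp only [mem_filter, mem_univ, true_and] at hq hq'
      exact ⟨q.1 i, fun h => absurd h hi, fun _ => ⟨q, hq, rfl⟩, hq'⟩
  choose m hm0 hm1 hm2 using hmin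
  -- Otherwise, placing the surplus at `i₁` gives a grid point exceeding `m i` in every coordinate
  -- whose corner is missing, against dominance.
  have hlarge : n < ∑ i, (m i + if .inr i ∉ t then 1 else 0) := by
    by_contra! hle
    obtain ⟨i, hi, hi'⟩ := hdom (fun i => (m i + if .inr i ∉ t then 1 else 0) +
      (Pi.single i₁ (n - ∑ i, (m i + if .inr i ∉ t then 1 else 0)) : ι → ℕ) i) (by
        rw [sum_add_distrib, sum_pi_single' i₁]
        simp only [mem_univ, if_true]
        omega)
    obtain ⟨q, hq, hqm⟩ := hm1 i hi
    have := hi' q hq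
    simp only [hi, not_false_eq_true, if_true] at this
    omega
  -- The coordinates of `q` sum to `n` and are bounded below by `m`, whose sum exceeds `n - #ι`; so
  -- no coordinate has more than `#ι` to spare.
  have hclose : ∀ q, .inl q ∈ t → ∀ i, q.1 i ≤ m i + Fintype.card ι := by
    intro q hq i
    have h1 : ∑ j, (if .inr j ∉ t then 1 else 0) ≤ Fintype.card ι := by
      refine (sum_le_card_nsmul univ _ 1 fun j _ => ?_).trans (by simp)
      split_ifs <;> simp
    have h2 := hsum q
    rw [sum_add_distrib] at hlarge
    have h3 : ∑ j ∈ univ.erase i, m j ≤ ∑ j ∈ univ.erase i, q.1 j :=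
      sum_le_sum fun j _ => hm2 j q hq
    rw [← add_sum_erase _ _ (mem_univ i)] at h2
    rw [← add_sum_erase univ m (mem_univ i)] at hlarge
    omega
  refine ⟨p.1, hsum p, fun i => ?_⟩
  by_cases hi : .inr i ∈ t
  · left
    have := hclose p hp i
    rw [hm0 i hi] at this
    omega
  · right
    obtain ⟨q, hq, hqi⟩ := hcol i hi
    refine ⟨q.1, hsum q, hqi, fun j => ?_⟩
    have h1 := hclose p hp j
    have h2 := hclose q hq j
    have h3 := hm2 j p hp
    have h4 := hm2 j q hq
    omega

/-- Colour a grid point by a coordinate that `f` does not decrease. In a colourful cell every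
coordinate is either small or not decreased at a nearby point, and uniform continuity carries this
over to `p`. -/
theorem exists_almost_fixed [Nontrivial ι] {f : (ι → ℝ) → ι → ℝ}
    (hf : ContinuousOn f (stdSimplex ℝ ι)) (hmaps : Set.MapsTo f (stdSimplex ℝ ι) (stdSimplex ℝ ι))
    {ε : ℝ} (hε : 0 < ε) : ∃ p ∈ stdSimplex ℝ ι, ∀ i, p i ≤ f p i + ε := by
  have huc := (isCompact_stdSimplex ℝ ι).uniformContinuousOn_of_continuous hf
  obtain ⟨δ, hδ, huc⟩ := Metric.uniformContinuousOn_iff.1 huc (ε / 2) (half_pos hε)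
  obtain ⟨n, hn⟩ := exists_nat_gt ((Fintype.card ι : ℝ) / min δ (ε / 2))
  have hmin : 0 < min δ (ε / 2) := lt_min hδ (half_pos hε)
  have hn0 : (0 : ℝ) < n := lt_of_le_of_lt (by positivity) hn
  have hsmall : (Fintype.card ι : ℝ) / n < min δ (ε / 2) := by
    rw [div_lt_iff₀ hmin] at hn
    rw [div_lt_iff₀ hn0]
    linarith
  have hmem : ∀ q : ι → ℕ, ∑ j, q j = n → (fun j => (q j : ℝ) / n) ∈ stdSimplex ℝ ι := by
    intro q hq
    refine ⟨fun j => by positivity, ?_⟩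
    rw [← sum_div, ← Nat.cast_sum, hq, div_self hn0.ne']
  have hcol : ∀ q : ι → ℕ, ∃ i, ∑ j, q j = n →
      (q i : ℝ) / n ≤ f (fun j => (q j : ℝ) / n) i := by
    intro q
    by_cases hq : ∑ j, q j = n
    -- Both vectors sum to 1, so `f` cannot decrease every coordinate.
    · by_contra! hcon
      have h1 := (hmem q hq).2
      have h2 := (hmaps (hmem q hq)).2
      have := sum_lt_sum_of_nonempty univ_nonempty fun i (_ : i ∈ univ) => (hcon i).2
      exact absurd (h2.trans h1.symm) this.ne
    · exact ⟨Classical.arbitrary ι, fun h => absurd h hq⟩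
  choose c hc using hcol
  obtain ⟨p, hp, hpc⟩ := exists_colourful_cell n c
  refine ⟨_, hmem p hp, fun i => ?_⟩
  rcases hpc i with hi | ⟨q, hq, hqi, hqp⟩
  · have h1 := (hmaps (hmem p hp)).1 i
    have h2 : (p i : ℝ) / n ≤ Fintype.card ι / n := by gcongr
    have h3 := hsmall.trans_le (min_le_right _ _)
    linarith
  · have h1 := hc q hq
    rw [hqi] at h1
    have hdiff : ∀ j, |(p j : ℝ) / n - q j / n| ≤ Fintype.card ι / n := by
      intro j
      rw [← sub_div, abs_div, abs_of_pos hn0]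
      have h2 : (q j : ℝ) ≤ p j + Fintype.card ι := by exact_mod_cast (hqp j).1
      have h3 : (p j : ℝ) ≤ q j + Fintype.card ι := by exact_mod_cast (hqp j).2
      gcongr
      rw [abs_le]
      constructor <;> linarith
    have hdist : dist (fun j => (p j : ℝ) / n) (fun j => (q j : ℝ) / n) < δ := by
      refine lt_of_le_of_lt ((dist_pi_le_iff (by positivity)).2 fun j => ?_)
        (hsmall.trans_le (min_le_left _ _))
      exact hdiff j
    have h2 := huc _ (hmem p hp) _ (hmem q hq) hdist
    have h3 := (dist_le_pi_dist _ _ i).trans_lt h2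
    rw [Real.dist_eq, abs_lt] at h3
    have h4 := abs_le.1 (hdiff i)
    have h5 := hsmall.trans_le (min_le_right _ _)
    linarith [h3.1, h4.2]

/-- Brouwer's fixed point theorem for the standard simplex. -/
theorem exists_fixed_point [Nontrivial ι] {f : (ι → ℝ) → ι → ℝ}
    (hf : ContinuousOn f (stdSimplex ℝ ι))
    (hmaps : Set.MapsTo f (stdSimplex ℝ ι) (stdSimplex ℝ ι)) :
    ∃ p ∈ stdSimplex ℝ ι, f p = p := by
  have hcont : ContinuousOn (fun x => ∑ i, max 0 (x i - f x i)) (stdSimplex ℝ ι) := by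
    refine continuousOn_finsetSum _ fun i _ => ?_
    have h1 : ContinuousOn (fun x : ι → ℝ => f x i) (stdSimplex ℝ ι) :=
      (continuous_apply i).comp_continuousOn hf
    fun_prop
  obtain ⟨p₀, hp₀, -⟩ := exists_almost_fixed hf hmaps one_pos
  -- Almost fixed points make the total decrease arbitrarily small, so its minimum is 0. At a
  -- minimiser `p ≤ f p` coordinatewise, and equal sums force equality.
  obtain ⟨p, hp, hmin⟩ := (isCompact_stdSimplex ℝ ι).exists_isMinOn ⟨p₀, hp₀⟩ hcont
  have hle : ∀ i, p i ≤ f p i := by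
    intro i
    by_contra! hlt
    have hcard : (0 : ℝ) < Fintype.card ι := by exact_mod_cast Fintype.card_pos
    obtain ⟨q, hq, hqi⟩ := exists_almost_fixed hf hmaps
      (show 0 < (p i - f p i) / (2 * Fintype.card ι) from
        div_pos (sub_pos.2 hlt) (by positivity))
    have h1 : ∑ j, max 0 (p j - f p j) ≤ ∑ j, max 0 (q j - f q j) := hmin hq
    have h2 : p i - f p i ≤ ∑ j, max 0 (p j - f p j) :=
      (le_max_right 0 _).trans
        (single_le_sum (f := fun j => max 0 (p j - f p j)) (fun j _ => le_max_left 0 _)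
          (mem_univ i))
    have h3 : ∑ j, max 0 (q j - f q j) ≤
        ∑ _j : ι, (p i - f p i) / (2 * Fintype.card ι) := by
      refine sum_le_sum fun j _ => max_le ?_ (by linarith [hqi j])
      exact (div_pos (sub_pos.2 hlt) (by positivity)).le
    have h4 : ∑ _j : ι, (p i - f p i) / (2 * Fintype.card ι) = (p i - f p i) / 2 := by
      rw [sum_const, card_univ, nsmul_eq_mul]
      field_simp
    linarith
  refine ⟨p, hp, funext fun i => ?_⟩
  have := (sum_eq_sum_iff_of_le fun i (_ : i ∈ univ) => hle i).1
    (hp.2.trans (hmaps hp).2.symm)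
  exact (this i (mem_univ i)).symm

end Brouwer

/-! ### Nash's theorem for finite games. -/

namespace Nash

open Finset

variable {N : Type*} [Fintype N] {A : N → Type*} [∀ i, Fintype (A i)]

/-- A retraction of the simplex on all strategies of all players onto the profiles of mixed
strategies, embedded with weight `1 / n` for each of the `n` players. -/
noncomputable def retract (x : (Σ i, A i) → ℝ) (i : N) (a : A i) : ℝ :=
  (x ⟨i, a⟩ + max 0 (1 / Fintype.card N - ∑ b, x ⟨i, b⟩) / Fintype.card (A i)) /
    max (1 / (Fintype.card N : ℝ)) (∑ b, x ⟨i, b⟩)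

/-- A block of mass below `1 / n` is filled up evenly to that mass. The denominator is the resulting
mass, and it never vanishes, which also gives continuity. -/
theorem retract_mem [Nonempty N] [∀ i, Nonempty (A i)] {x : (Σ i, A i) → ℝ} (hx : ∀ z, 0 ≤ x z)
    (i : N) : retract x i ∈ stdSimplex ℝ (A i) := by
  have hN : (0 : ℝ) < 1 / Fintype.card N := by
    have : (0 : ℝ) < Fintype.card N := by exact_mod_cast Fintype.card_pos
    positivity
  have hA : (0 : ℝ) < Fintype.card (A i) := by exact_mod_cast Fintype.card_pos
  have hmax : 0 < max (1 / (Fintype.card N : ℝ)) (∑ b, x ⟨i, b⟩) := lt_max_of_lt_left hN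
  refine ⟨fun a => div_nonneg (add_nonneg (hx _)
    (div_nonneg (le_max_left _ _) hA.le)) hmax.le, ?_⟩
  simp only [retract]
  rw [← sum_div, sum_add_distrib, sum_const, card_univ, nsmul_eq_mul, mul_div_cancel₀ _ hA.ne',
    div_eq_one_iff_eq hmax.ne', ← max_add_add_left]
  rw [add_zero, add_sub_cancel, max_comm]

theorem retract_eq [Nonempty N] {x : (Σ i, A i) → ℝ} {i : N}
    (hx : ∑ b, x ⟨i, b⟩ = 1 / Fintype.card N) (a : A i) :
    retract x i a = Fintype.card N * x ⟨i, a⟩ := by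
  have : (Fintype.card N : ℝ) ≠ 0 := by exact_mod_cast Fintype.card_ne_zero
  simp only [retract, hx, sub_self, max_self, zero_div, add_zero]
  field_simp

theorem continuous_retract [Nonempty N] :
    Continuous (retract : ((Σ i, A i) → ℝ) → (i : N) → A i → ℝ) := by
  refine continuous_pi fun i => continuous_pi fun a => ?_
  have hN : (0 : ℝ) < 1 / Fintype.card N := by
    have : (0 : ℝ) < Fintype.card N := by exact_mod_cast Fintype.card_pos
    positivity
  refine Continuous.div (by fun_prop) (by fun_prop) fun x => ?_
  exact (lt_max_of_lt_left hN).ne'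

/-- The positive part of the gain of player `i` from replacing `σ i` by the pure strategy `a`,
when `v σ i a` is the payoff from the latter. -/
noncomputable def gain (v : ((i : N) → A i → ℝ) → (i : N) → A i → ℝ) (σ : (i : N) → A i → ℝ)
    (i : N) (a : A i) : ℝ :=
  max 0 (v σ i a - ∑ b, σ i b * v σ i b)

/-- Nash's map, on the scaled profiles. -/
noncomputable def improve (v : ((i : N) → A i → ℝ) → (i : N) → A i → ℝ)
    (σ : (i : N) → A i → ℝ) (z : Σ i, A i) : ℝ :=
  (σ z.1 z.2 + gain v σ z.1 z.2) / (Fintype.card N * (1 + ∑ b, gain v σ z.1 b))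

omit [Fintype N] in
theorem gain_nonneg (v : ((i : N) → A i → ℝ) → (i : N) → A i → ℝ) (σ : (i : N) → A i → ℝ)
    (i : N) (a : A i) : 0 ≤ gain v σ i a :=
  le_max_left _ _

omit [Fintype N] in
theorem one_add_sum_gain_pos (v : ((i : N) → A i → ℝ) → (i : N) → A i → ℝ)
    (σ : (i : N) → A i → ℝ) (i : N) : 0 < 1 + ∑ b, gain v σ i b :=
  add_pos_of_pos_of_nonneg one_pos (sum_nonneg fun b _ => gain_nonneg v σ i b)

theorem continuous_improve [Nonempty N] {v : ((i : N) → A i → ℝ) → (i : N) → A i → ℝ}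
    (hv : Continuous v) : Continuous (improve v) := by
  have hv' : ∀ i a, Continuous fun σ => v σ i a := fun i a => by fun_prop
  have hg : ∀ i a, Continuous fun σ => gain v σ i a := fun i a => by
    unfold gain
    fun_prop
  refine continuous_pi fun z => Continuous.div ?_ ?_ fun σ => ?_
  · exact Continuous.add (by fun_prop) (hg _ _)
  · exact continuous_const.mul (continuous_const.add (continuous_finsetSum _ fun b _ => hg _ b))
  · exact mul_ne_zero (by exact_mod_cast Fintype.card_ne_zero) (one_add_sum_gain_pos v σ z.1).ne'

theorem sum_improve [Nonempty N] (v : ((i : N) → A i → ℝ) → (i : N) → A i → ℝ)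
    {σ : (i : N) → A i → ℝ} {i : N} (hσ : σ i ∈ stdSimplex ℝ (A i)) :
    ∑ a, improve v σ ⟨i, a⟩ = 1 / Fintype.card N := by
  have h1 := (one_add_sum_gain_pos v σ i).ne'
  have h2 : ∀ a, improve v σ ⟨i, a⟩ =
      (σ i a + gain v σ i a) / (Fintype.card N * (1 + ∑ b, gain v σ i b)) := fun _ => rfl
  simp only [h2]
  rw [← sum_div, sum_add_distrib, hσ.2, mul_comm, ← div_div, div_self h1]

theorem improve_mem [Nonempty N] (v : ((i : N) → A i → ℝ) → (i : N) → A i → ℝ)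
    {σ : (i : N) → A i → ℝ} (hσ : ∀ i, σ i ∈ stdSimplex ℝ (A i)) :
    improve v σ ∈ stdSimplex ℝ (Σ i, A i) := by
  refine ⟨fun z => ?_, ?_⟩
  · exact div_nonneg (add_nonneg ((hσ z.1).1 _) (gain_nonneg v σ _ _))
      (mul_nonneg (Nat.cast_nonneg _) (one_add_sum_gain_pos v σ _).le)
  · have : (Fintype.card N : ℝ) ≠ 0 := by exact_mod_cast Fintype.card_ne_zero
    rw [Fintype.sum_sigma, sum_congr rfl fun i _ => sum_improve v (hσ i), sum_const, card_univ,
      nsmul_eq_mul]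
    field_simp

omit [Fintype N] in
-- Excess payoffs over the average have `σ`-mean zero. As `h` makes the gains proportional to `σ` or
-- all zero, the sum of gain times excess, which is the sum of squared gains, vanishes.
theorem gain_eq_zero {v : ((i : N) → A i → ℝ) → (i : N) → A i → ℝ} {σ : (i : N) → A i → ℝ} {i : N}
    (hσ : σ i ∈ stdSimplex ℝ (A i))
    (h : ∀ a, σ i a * ∑ b, gain v σ i b = gain v σ i a) (a : A i) : gain v σ i a = 0 := by
  have hsq : ∀ a, gain v σ i a * (v σ i a - ∑ b, σ i b * v σ i b) = gain v σ i a * gain v σ i a := by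
    intro a
    rcases le_total (v σ i a - ∑ b, σ i b * v σ i b) 0 with h0 | h0
    · have : gain v σ i a = 0 := max_eq_left h0
      rw [this, zero_mul, zero_mul]
    · have : gain v σ i a = v σ i a - ∑ b, σ i b * v σ i b := max_eq_right h0
      rw [← this]
  have hsum : ∑ a, gain v σ i a * gain v σ i a = 0 := by
    calc ∑ a, gain v σ i a * gain v σ i a
        = ∑ a, (σ i a * v σ i a - σ i a * ∑ b, σ i b * v σ i b) * ∑ b, gain v σ i b := by
          refine sum_congr rfl fun a _ => ?_
          rw [← hsq a]
          nth_rw 1 [← h a]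
          ring
      _ = 0 := by
          rw [← sum_mul, sum_sub_distrib, ← sum_mul, hσ.2, one_mul, sub_self, zero_mul]
  exact mul_self_eq_zero.1
    ((sum_eq_zero_iff_of_nonneg fun a _ => mul_self_nonneg _).1 hsum a (mem_univ a))

theorem exists_stationary [DecidableEq N] [Nontrivial N] [∀ i, Nonempty (A i)]
    [∀ i, DecidableEq (A i)] {v : ((i : N) → A i → ℝ) → (i : N) → A i → ℝ} (hv : Continuous v) :
    ∃ σ : (i : N) → A i → ℝ, (∀ i, σ i ∈ stdSimplex ℝ (A i)) ∧
      ∀ i a, v σ i a ≤ ∑ b, σ i b * v σ i b := by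
  have : Nontrivial (Σ i, A i) := by
    obtain ⟨i, j, hij⟩ := exists_pair_ne N
    exact ⟨⟨i, Classical.arbitrary _⟩, ⟨j, Classical.arbitrary _⟩, fun h => hij (congrArg Sigma.fst h)⟩
  obtain ⟨x, hx, hfix⟩ := Brouwer.exists_fixed_point (f := fun x => improve v (retract x))
    ((continuous_improve hv).comp continuous_retract).continuousOn
    fun x hx => improve_mem v (retract_mem hx.1)
  have hσ := retract_mem hx.1
  refine ⟨retract x, hσ, fun i a => ?_⟩
  -- The image of `improve` has block masses exactly `1 / n`, so on the fixed point the retraction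
  -- is mere scaling and the fixed point is one of Nash's map.
  have hsum : ∑ b, x ⟨i, b⟩ = 1 / Fintype.card N := by
    rw [← sum_improve v (hσ i)]
    exact sum_congr rfl fun b _ => (congrFun hfix _).symm
  have hgain : ∀ a, retract x i a * ∑ b, gain v (retract x) i b = gain v (retract x) i a := by
    intro a
    have h1 := congrFun hfix ⟨i, a⟩
    have h2 := one_add_sum_gain_pos v (retract x) i
    have h3 : (0 : ℝ) < Fintype.card N := by exact_mod_cast Fintype.card_pos
    simp only [improve] at h1
    rw [div_eq_iff (mul_pos h3 h2).ne', ← mul_assoc, mul_comm (x _), ← retract_eq hsum] at h1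
    linarith
  have := gain_eq_zero (hσ i) hgain a
  have h := le_max_right 0 (v (retract x) i a - ∑ b, retract x i b * v (retract x) i b)
  rw [show max 0 _ = (0 : ℝ) from this] at h
  linarith

variable [DecidableEq N]

/-- The expected value of `u` when the players independently use the mixed strategies `σ`. -/
def expectation (u : ((i : N) → A i) → ℝ) (σ : (i : N) → A i → ℝ) : ℝ :=
  ∑ s, u s * ∏ j, σ j (s j)

/-- The expected value of `u` when player `i` uses the pure strategy `a`, and the others use the
mixed strategies `σ`. -/
def pureExpectation [∀ i, DecidableEq (A i)] (u : ((i : N) → A i) → ℝ) (σ : (i : N) → A i → ℝ)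
    (i : N) (a : A i) : ℝ :=
  ∑ s : (i : N) → A i, if s i = a then u s * ∏ j ∈ univ.erase i, σ j (s j) else 0

/-- Linearity in a player's own strategy: it reduces deviations to pure ones. -/
theorem expectation_update [∀ i, DecidableEq (A i)] (u : ((i : N) → A i) → ℝ)
    (σ : (i : N) → A i → ℝ) (i : N) (τ : A i → ℝ) :
    expectation u (Function.update σ i τ) = ∑ a, τ a * pureExpectation u σ i a := by
  simp only [expectation, pureExpectation, mul_sum]
  rw [sum_comm]
  refine sum_congr rfl fun s _ => ?_
  simp only [mul_ite, mul_zero, sum_ite_eq, mem_univ, if_true]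
  rw [← mul_prod_erase _ _ (mem_univ i), Function.update_self,
    prod_congr rfl fun j hj => by rw [Function.update_of_ne (mem_erase.1 hj).1]]
  ring

/-- Nash's theorem: a finite game has an equilibrium in mixed strategies. -/
theorem exists_equilibrium [Nontrivial N] [∀ i, Nonempty (A i)]
    (u : N → ((i : N) → A i) → ℝ) :
    ∃ σ : (i : N) → A i → ℝ, (∀ i, σ i ∈ stdSimplex ℝ (A i)) ∧
      ∀ i, ∀ τ ∈ stdSimplex ℝ (A i),
        expectation (u i) (Function.update σ i τ) ≤ expectation (u i) σ := by
  classical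
  obtain ⟨σ, hσ, h⟩ := exists_stationary (A := A)
    (v := fun σ i a => pureExpectation (u i) σ i a) (by
      refine continuous_pi fun i => continuous_pi fun a => continuous_finsetSum _ fun s _ => ?_
      split_ifs <;> fun_prop)
  refine ⟨σ, hσ, fun i τ hτ => ?_⟩
  have h2 := expectation_update (u i) σ i (σ i)
  rw [Function.update_eq_self] at h2
  rw [expectation_update, h2]
  calc ∑ a, τ a * pureExpectation (u i) σ i a
      ≤ ∑ a, τ a * ∑ b, σ i b * pureExpectation (u i) σ i b :=
        sum_le_sum fun a _ => mul_le_mul_of_nonneg_left (h i a) (hτ.1 a)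
    _ = ∑ b, σ i b * pureExpectation (u i) σ i b := by rw [← sum_mul, hτ.2, one_mul]

end Nash

/-! ### Coalition structure formation games as finite games. -/

namespace CoalitionFormation

variable {N : Type*} [Fintype N] [DecidableEq N] {A : N → Type*}

open Classical in
/-- The payoff of player `i` from a pure strategy profile. -/
noncomputable def Game.purePayoff {S : (i : N) → CoalitionStructure N → Finset (A i)} {K : ℕ}
    (Γ : Game S K) (i : N) (s : Profile S K) : ℝ :=
  ∑ P : partitions N K, if h : s ∈ Γ.mechanism.domain P then Γ.payoff i P ⟨s, h⟩ else 0

theorem Game.expectedUtility_eq {S : (i : N) → CoalitionStructure N → Finset (A i)} {K : ℕ}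
    (Γ : Game S K) (σ : MixedProfile S K) (i : N) :
    Γ.expectedUtility σ i =
      Nash.expectation (Γ.purePayoff i) fun j => (σ j : strategySet S K j → ℝ) := by
  classical
  simp only [Game.expectedUtility, Nash.expectation, Game.purePayoff, Finset.sum_mul]
  rw [Finset.sum_comm]
  refine Finset.sum_congr rfl fun P _ => ?_
  have h : ∀ s ∉ (Γ.mechanism.domain P).toFinset,
      (if h : s ∈ Γ.mechanism.domain P then Γ.payoff i P ⟨s, h⟩ else 0) *
        ∏ j, (σ j : strategySet S K j → ℝ) (s j) = 0 := fun s hs => by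
    rw [dif_neg fun h => hs (Set.mem_toFinset.2 h), zero_mul]
  rw [← Finset.sum_subset (Finset.subset_univ (Γ.mechanism.domain P).toFinset)
    fun s _ hs => h s hs]
  rw [Finset.sum_subtype (p := fun s => s ∈ Γ.mechanism.domain P) _
    fun s => Set.mem_toFinset]
  refine Finset.sum_congr rfl fun s _ => ?_
  rw [dif_pos s.2]

theorem Game.exists_isEquilibrium [Nontrivial N]
    {S : (i : N) → CoalitionStructure N → Finset (A i)} {K : ℕ}
    (hS : ∀ i, (strategySet S K i).Nonempty) (Γ : Game S K) :
    ∃ σ : MixedProfile S K, Γ.IsEquilibrium σ := by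
  have : ∀ i, Nonempty (strategySet S K i) := fun i => (hS i).to_subtype
  obtain ⟨σ, hσ, h⟩ := Nash.exists_equilibrium Γ.purePayoff
  refine ⟨fun i => ⟨σ i, hσ i⟩, fun i τ => ?_⟩
  rw [Γ.expectedUtility_eq, Γ.expectedUtility_eq]
  have hupd : (fun j => (Function.update (fun i => (⟨σ i, hσ i⟩ : MixedStrategy S K i)) i τ j :
      strategySet S K j → ℝ)) = Function.update σ i τ.1 := by
    funext j
    by_cases hj : j = i
    · subst hj
      rw [Function.update_self, Function.update_self]
      rfl
    · rw [Function.update_of_ne hj, Function.update_of_ne hj]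
      rfl
  rw [hupd]
  exact h i τ.1 τ.2

end CoalitionFormation

theorem mainTheorem1 {N : Type*} [Fintype N] [DecidableEq N] (hN : 2 ≤ Fintype.card N)
    {A : N → Type*} (S : (i : N) → CoalitionFormation.CoalitionStructure N → Finset (A i)) :
    (∀ K : Set.Icc 1 (Fintype.card N),
      (∀ i, (CoalitionFormation.strategySet S K i).Nonempty) →
        ∀ Γ : CoalitionFormation.Game S K,
          ∃ σ : CoalitionFormation.MixedProfile S K, Γ.IsEquilibrium σ) ∧
    ((∀ i, (CoalitionFormation.strategySet S 1 i).Nonempty) →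
      ∀ Γ : (K : Set.Icc 1 (Fintype.card N)) → CoalitionFormation.Game S K,
        CoalitionFormation.IsNested Γ →
          ∃ σ : (K : Set.Icc 1 (Fintype.card N)) → CoalitionFormation.MixedProfile S K,
            ∀ K, (Γ K).IsEquilibrium (σ K)) := by
  have : Nontrivial N := Fintype.one_lt_card_iff_nontrivial.1 hN
  refine ⟨fun K hS Γ => Γ.exists_isEquilibrium hS, fun hS Γ _ => ?_⟩
  choose σ hσ using fun K => (Γ K).exists_isEquilibrium fun i =>
    (hS i).mono (CoalitionFormation.strategySet_mono S K.2.1 i)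
  exact ⟨σ, hσ⟩
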